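/- Let $0\le\varepsilon<1/2$. There is a constant $c>0$, depending only on $\varepsilon$, such that the following holds for every finite field $\mathbb{F}_q$ and all integers $m\ge n\ge 0$. Consider quantum algorithms with matrix-vector queries to an unknown matrix $M\in\mathbb{F}_q^{m\times n}$: the algorithm acts on a register $x\in\mathbb{F}_q^n$, a register $y\in\mathbb{F}_q^m$ and a finite-dimensional workspace, starts in a fixed basis state, alternates fixed unitaries (independent of $M$) with applications of the oracle $|x,y\rangle\mapsto|x,y+Mx\rangle$ (each application is one query), and finally measures in the computational basis to accept or reject. If such an algorithm accepts with probability at least $1-\varepsilon$ whenever $\mathrm{rank}(M)=n$, and accepts with probability at most $\varepsilon$ whenever $\mathrm{rank}(M)\le n/2$, then it makes at least $c\,n$ queries. In particular (with $\varepsilon=1/3$), the bounded-error matrix-vector quantum query complexity of distinguishing $\mathrm{rank}(M)=n$ from $\mathrm{rank}(M)\le n/2$ is $\Omega(n)$. -/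

import Mathlib

open scoped Matrix

namespace MatVec

/-- Labels `(x, y, w)` of the computational basis: query register `x ∈ F^n`, answer register
`y ∈ F^m`, and a workspace register `w` of arbitrary finite size `d`. -/
abbrev Label (F : Type*) (m n d : ℕ) : Type _ := (Fin n → F) × (Fin m → F) × Fin d

/-- The matrix-vector oracle `|x, y, w⟩ ↦ |x, y + M x, w⟩`, extended linearly to amplitude vectors:
the new amplitude at `(x, y, w)` is the old amplitude at `(x, y - M x, w)`. -/
def oracle {F : Type*} [Field F] {m n d : ℕ} (M : Matrix (Fin m) (Fin n) F) :
    (Label F m n d → ℂ) →ₗ[ℂ] (Label F m n d → ℂ) where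
  toFun ψ := fun b => ψ (b.1, b.2.1 - M *ᵥ b.1, b.2.2)
  map_add' _ _ := rfl
  map_smul' _ _ := rfl

/-- On basis states the oracle acts as `|x, y, w⟩ ↦ |x, y + M x, w⟩`. -/
theorem oracle_single {F : Type*} [Field F] [DecidableEq F] {m n d : ℕ}
    (M : Matrix (Fin m) (Fin n) F) (x : Fin n → F) (y : Fin m → F) (w : Fin d) :
    oracle M (Pi.single ((x, y, w) : Label F m n d) (1 : ℂ)) =
      Pi.single ((x, y + M *ᵥ x, w) : Label F m n d) (1 : ℂ) := by
  funext b
  obtain ⟨x', y', w'⟩ := b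
  have h : ((x', y' - M *ᵥ x', w') : Label F m n d) = (x, y, w) ↔
      ((x', y', w') : Label F m n d) = (x, y + M *ᵥ x, w) := by
    simp only [Prod.mk.injEq]
    constructor
    · rintro ⟨rfl, h, rfl⟩
      exact ⟨rfl, by rw [← h]; simp, rfl⟩
    · rintro ⟨rfl, h, rfl⟩
      exact ⟨rfl, by rw [h]; simp, rfl⟩
  simp only [oracle, LinearMap.coe_mk, AddHom.coe_mk, Pi.single_apply, h]

/-- A quantum algorithm with matrix-vector queries to an `m × n` matrix over `F`: it starts in a
fixed basis state, alternates fixed unitaries (independent of the matrix) with oracle calls, and at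
the end measures in the computational basis, accepting if the outcome lies in `accept`. -/
structure QueryAlgorithm (F : Type*) [Field F] [Fintype F] [DecidableEq F] (m n : ℕ) where
  /-- dimension of the workspace register -/
  workDim : ℕ
  /-- number of queries -/
  queries : ℕ
  /-- initial basis state -/
  start : Label F m n workDim
  /-- `gate 0` is applied before the first query and `gate k` right after the `k`-th query;
  gates with index larger than `queries` are never used -/
  gate : ℕ → Matrix.unitaryGroup (Label F m n workDim) ℂ
  /-- accepted measurement outcomes -/
  accept : Finset (Label F m n workDim)

namespace QueryAlgorithm

variable {F : Type*} [Field F] [Fintype F] [DecidableEq F] {m n : ℕ}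

/-- The state after `k` queries to `M` and the gate that follows the last of them. -/
def state (A : QueryAlgorithm F m n) (M : Matrix (Fin m) (Fin n) F) :
    ℕ → (Label F m n A.workDim → ℂ)
  | 0 => (A.gate 0).1 *ᵥ Pi.single A.start 1
  | k + 1 => (A.gate (k + 1)).1 *ᵥ oracle M (A.state M k)

/-- The probability that the algorithm accepts the input matrix `M`. -/
noncomputable def acceptProb (A : QueryAlgorithm F m n) (M : Matrix (Fin m) (Fin n) F) : ℝ :=
  ∑ b ∈ A.accept, ‖A.state M A.queries b‖ ^ 2

/-- The algorithm distinguishes `rank M = n` (accept) from `rank M ≤ n / 2` (reject), with error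
probability at most `ε` on every matrix satisfying one of the two conditions. -/
def TestsRank (A : QueryAlgorithm F m n) (ε : ℝ) : Prop :=
  (∀ M : Matrix (Fin m) (Fin n) F, M.rank = n → 1 - ε ≤ A.acceptProb M) ∧
  (∀ M : Matrix (Fin m) (Fin n) F, (M.rank : ℝ) ≤ (n : ℝ) / 2 → A.acceptProb M ≤ ε)

end QueryAlgorithm

end MatVec

/-! ## Counting linear maps with prescribed kernels over a finite field -/

section Counting

open Module LinearMap

variable {F : Type*} [Field F]
  {T : Type*} [AddCommGroup T] [Module F T]
  {V : Type*} [AddCommGroup V] [Module F V] [Finite V]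
  {W : Type*} [AddCommGroup W] [Module F W]

/-! This is the polynomial method. After `k` queries every amplitude is a combination of products of
`k` indicators `[L x = y]`, so the acceptance probability lies in the `2k`-th power of `querySpan`.
Averaging over automorphisms of source and target turns such a function into a polynomial of degree
at most `2k` in `|ker L| = q ^ (n - rank)` (`exists_polynomial_automorphismSum`). The resulting `P`
is at least `1 - ε` at `1` and lies in `[0, ε]` at `q ^ j` for `n / 2 ≤ j ≤ n`. Rescale so that the
top `d + 1` of these powers become `1, q, …, q ^ d`. Boundedness on a geometric progression controls
the coefficients by `13 ^ d`, uniformly in `q` (`sum_norm_coeff_le_of_geometric`). After rescaling,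
the points `1` and `q ^ ⌈n / 2⌉` are exponentially close to `0`, so the gap `1 - 2ε` between their
values forces `d` to be linear in `n`. -/

instance finite_linearMap [Finite T] : Finite (T →ₗ[F] V) :=
  Finite.of_injective _ DFunLike.coe_injective

instance finite_linearEquiv : Finite (V ≃ₗ[F] V) :=
  Finite.of_injective _ DFunLike.coe_injective

theorem natCard_linearMap [Finite T] : Nat.card (T →ₗ[F] V) = Nat.card V ^ finrank F T := by
  rw [natCard_eq_pow_finrank (K := F) (V := T →ₗ[F] V), natCard_eq_pow_finrank (K := F) (V := V),
    finrank_linearMap, mul_comm, pow_mul]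

/-- The number of `Z` with `S ≤ ker Z` and `R ≤ ker (L ∘ Z)` is, for `S ≤ R`, a constant times a
power of the cardinality of `ker L`. -/
theorem natCard_le_ker_of_le [Finite T] {S R : Submodule F T} (hSR : S ≤ R) :
    ∃ N a : ℕ, a ≤ finrank F T ∧ ∀ L : V →ₗ[F] W,
      Nat.card {Z : T →ₗ[F] V // S ≤ ker Z ∧ R ≤ ker (L ∘ₗ Z)} = N * Nat.card (ker L) ^ a := by
  -- Decompose `T = S ⊕ A ⊕ B` with `R = S ⊕ A`: an admissible `Z` is zero on `S`, any map into `ker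
  -- L` on `A`, and arbitrary on `B`.
  obtain ⟨B, hB⟩ := Submodule.exists_isCompl R
  obtain ⟨A, hA⟩ := Submodule.exists_isCompl (S.comap R.subtype)
  refine ⟨Nat.card V ^ finrank F B, finrank F A,
    (Submodule.finrank_le A).trans (Submodule.finrank_le R), fun L => ?_⟩
  rw [← natCard_linearMap, ← natCard_linearMap, ← Nat.card_prod]
  symm
  let φ : (B →ₗ[F] V) × (A →ₗ[F] ker L) → (T →ₗ[F] V) := fun p =>
    ofIsCompl hB (ofIsCompl hA 0 ((ker L).subtype ∘ₗ p.2)) p.1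
  have hφR : ∀ p (x : R), φ p x = ofIsCompl hA 0 ((ker L).subtype ∘ₗ p.2) x := fun p x =>
    ofIsCompl_apply_left hB x
  have hφB : ∀ p (x : B), φ p x = p.1 x := fun p x => ofIsCompl_apply_right hB x
  have hφS : ∀ p, S ≤ ker (φ p) := by
    intro p x hx
    have h1 := hφR p ⟨x, hSR hx⟩
    rw [mem_ker]
    refine h1.trans ?_
    exact ofIsCompl_apply_left hA (⟨⟨x, hSR hx⟩, hx⟩ : S.comap R.subtype)
  have hφA : ∀ p (x : A), φ p (x : R) = (p.2 x : V) := fun p x =>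
    (hφR p x).trans (ofIsCompl_apply_right hA x)
  have hφK : ∀ p, R ≤ ker (L ∘ₗ φ p) := by
    intro p x hx
    obtain ⟨u, v, huv, -⟩ := Submodule.existsUnique_add_of_isCompl hA ⟨x, hx⟩
    have hx' : x = ((u : R) : T) + ((v : R) : T) := by
      have := congrArg Subtype.val huv
      simpa using this.symm
    have hu : φ p ((u : R) : T) = 0 := mem_ker.1 (hφS p u.2)
    rw [mem_ker, comp_apply, hx', map_add, hu, hφA, zero_add]
    exact (p.2 v).2
  refine Nat.card_congr (Equiv.ofBijective (fun p => ⟨φ p, hφS p, hφK p⟩) ⟨?_, ?_⟩)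
  · intro p p' h
    have h' : φ p = φ p' := congrArg Subtype.val h
    refine Prod.ext ?_ ?_
    · ext x
      rw [← hφB, h', hφB]
    · ext x
      rw [← hφA, h', hφA]
  · rintro ⟨Z, hS, hR⟩
    refine ⟨(Z ∘ₗ B.subtype, codRestrict (ker L) (Z ∘ₗ R.subtype ∘ₗ A.subtype)
      fun x => hR x.1.2), Subtype.ext ?_⟩
    refine ofIsCompl_eq hB (fun u => ?_) fun v => rfl
    refine congrArg (fun f : R →ₗ[F] V => f u)
      (?_ : ofIsCompl hA 0 _ = Z ∘ₗ R.subtype)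
    exact ofIsCompl_eq hA (fun u => (mem_ker.1 (hS u.2)).symm) fun v => rfl

/-- Since `ker Z ≤ ker (L ∘ Z)`, replacing `R` by `S ⊔ R` does not change the condition. -/
theorem natCard_le_ker [Finite T] (S R : Submodule F T) :
    ∃ N a : ℕ, a ≤ finrank F T ∧ ∀ L : V →ₗ[F] W,
      Nat.card {Z : T →ₗ[F] V // S ≤ ker Z ∧ R ≤ ker (L ∘ₗ Z)} = N * Nat.card (ker L) ^ a := by
  obtain ⟨N, a, ha, h⟩ := natCard_le_ker_of_le (V := V) (W := W) (le_sup_left : S ≤ S ⊔ R)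
  refine ⟨N, a, ha, fun L => (Nat.card_congr (Equiv.subtypeEquivRight fun Z => ?_)).trans (h L)⟩
  rw [sup_le_iff]
  exact ⟨fun h => ⟨h.1, h.1.trans (ker_le_ker_comp Z L), h.2⟩, fun h => ⟨h.1, h.2.2⟩⟩

open Polynomial in
/-- The number of `Z` with prescribed `ker Z` and `ker (L ∘ Z)` is a polynomial of degree at most
`finrank F T` in the cardinality of `ker L`. -/
theorem exists_polynomial_natCard_ker_eq [Finite T] (p : Submodule F T × Submodule F T) :
    ∃ P : ℂ[X], P.natDegree ≤ finrank F T ∧ ∀ L : V →ₗ[F] W,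
      (Nat.card {Z : T →ₗ[F] V // (ker Z, ker (L ∘ₗ Z)) = p} : ℂ) =
        P.eval (Nat.card (ker L) : ℂ) := by
  classical
  have : Finite (Submodule F T) := Finite.of_injective _ SetLike.coe_injective
  have := Fintype.ofFinite (Submodule F T)
  have := Fintype.ofFinite (T →ₗ[F] V)
  -- Möbius inversion from the top of the poset of pairs: the count for `≥ p` is a monomial, and the
  -- counts for pairs strictly above `p` are subtracted.
  induction p using WellFoundedGT.induction with
  | ind p ih =>
  choose! Q hQdeg hQ using ih
  obtain ⟨N, a, ha, h⟩ := natCard_le_ker (V := V) (W := W) p.1 p.2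
  refine ⟨C (N : ℂ) * X ^ a - ∑ r with p < r, Q r, ?_, fun L => ?_⟩
  · refine (natDegree_sub_le _ _).trans (max_le ((natDegree_C_mul_X_pow_le _ _).trans ha) ?_)
    exact natDegree_sum_le_of_forall_le _ _ fun r hr => hQdeg r (Finset.mem_filter.1 hr).2
  · have key : Nat.card {Z : T →ₗ[F] V // p.1 ≤ ker Z ∧ p.2 ≤ ker (L ∘ₗ Z)} =
        ∑ r with p ≤ r, Nat.card {Z : T →ₗ[F] V // (ker Z, ker (L ∘ₗ Z)) = r} := by
      simp only [Nat.card_eq_fintype_card, Fintype.card_subtype]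
      rw [Finset.card_eq_sum_card_fiberwise (f := fun Z => (ker Z, ker (L ∘ₗ Z)))
        (t := Finset.univ.filter fun r => p ≤ r)]
      · refine Finset.sum_congr rfl fun r hr => congrArg Finset.card ?_
        ext Z
        simp only [Finset.mem_filter, Finset.mem_univ, true_and, and_iff_right_iff_imp]
        rintro rfl
        exact (Finset.mem_filter.1 hr).2
      · intro Z hZ
        simpa [Prod.le_def] using hZ
    have hsplit : (Finset.univ.filter fun r => p ≤ r) =
        insert p (Finset.univ.filter fun r => p < r) := by
      ext r
      simp [le_iff_eq_or_lt, eq_comm]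
    rw [h L, hsplit, Finset.sum_insert (by simp)] at key
    have key' := congrArg (Nat.cast : ℕ → ℂ) key
    push_cast at key'
    simp only [eval_sub, eval_mul, eval_C, eval_pow, eval_X, eval_finsetSum]
    rw [key', Finset.sum_congr rfl fun r hr => (hQ r (Finset.mem_filter.1 hr).2 L)]
    ring

/-- Two maps into a finite space with the same kernel differ by an automorphism of the target. -/
theorem exists_linearEquiv_comp_eq {A B : T →ₗ[F] V} (h : ker A = ker B) :
    ∃ g : V ≃ₗ[F] V, g.toLinearMap ∘ₗ A = B := by
  obtain ⟨g, hg⟩ := Submodule.exists_linearEquiv_restrict_eq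
    (A.quotKerEquivRange.symm ≪≫ₗ Submodule.quotEquivOfEq _ _ h ≪≫ₗ B.quotKerEquivRange)
  refine ⟨g, LinearMap.ext fun x => ?_⟩
  have := hg ⟨A x, mem_range_self A x⟩
  rw [comp_apply]
  refine this.symm.trans ?_
  have h1 : A.quotKerEquivRange.symm ⟨A x, mem_range_self A x⟩ = (ker A).mkQ x := by
    rw [LinearEquiv.symm_apply_eq]
    rfl
  simp [h1]

open Classical in
-- Maps with equal kernels form one orbit, and the automorphisms carrying `A` to `B` form a coset of
-- the stabilizer of `B`.
theorem natCard_linearEquiv_comp_eq (A B : T →ₗ[F] V) :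
    Nat.card {g : V ≃ₗ[F] V // g.toLinearMap ∘ₗ A = B} =
      if ker A = ker B then Nat.card {g : V ≃ₗ[F] V // g.toLinearMap ∘ₗ B = B} else 0 := by
  split_ifs with h
  · obtain ⟨g₀, hg₀⟩ := exists_linearEquiv_comp_eq h
    refine Nat.card_congr ⟨fun g => ⟨g₀.symm ≪≫ₗ g.1, ?_⟩, fun g => ⟨g₀ ≪≫ₗ g.1, ?_⟩,
      fun g => ?_, fun g => ?_⟩
    · refine LinearMap.ext fun x => ?_
      have h1 := LinearMap.congr_fun hg₀ x
      have h2 := LinearMap.congr_fun g.2 x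
      simp only [comp_apply, LinearEquiv.coe_coe, LinearEquiv.trans_apply] at *
      rw [← h1, LinearEquiv.symm_apply_apply, h2, h1]
    · refine LinearMap.ext fun x => ?_
      have h1 := LinearMap.congr_fun hg₀ x
      have h2 := LinearMap.congr_fun g.2 x
      simp only [comp_apply, LinearEquiv.coe_coe, LinearEquiv.trans_apply] at *
      rw [h1, h2]
    · ext x; simp
    · ext x; simp
  · rw [Nat.card_eq_zero]
    refine Or.inl ⟨fun g => h ?_⟩
    rw [← g.2, LinearEquiv.ker_comp]

open Classical in
-- The same count by the stabilizer of the starting map, for use when `A` is fixed and `B` varies.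
theorem natCard_linearEquiv_comp_eq' (A B : T →ₗ[F] V) :
    Nat.card {g : V ≃ₗ[F] V // g.toLinearMap ∘ₗ A = B} =
      if ker B = ker A then Nat.card {g : V ≃ₗ[F] V // g.toLinearMap ∘ₗ A = A} else 0 := by
  rw [← natCard_linearEquiv_comp_eq]
  have aux : ∀ (A B : T →ₗ[F] V) (g : V ≃ₗ[F] V), g.toLinearMap ∘ₗ A = B →
      g.symm.toLinearMap ∘ₗ B = A := by
    rintro A B g rfl
    ext x
    simp
  exact Nat.card_congr ((Equiv.mk LinearEquiv.symm LinearEquiv.symm (fun _ => rfl)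
    fun _ => rfl).subtypeEquiv fun g => ⟨aux A B g, aux B A g.symm⟩)

end Counting

/-! ## Averaging products of query indicators over automorphisms -/

section Averaging

open Module LinearMap

variable {F : Type*} [Field F]
  {T : Type*} [AddCommGroup T] [Module F T]
  {V : Type*} [AddCommGroup V] [Module F V]
  {W : Type*} [AddCommGroup W] [Module F W]

open Classical in
/-- The indicator of the event that the unknown linear map sends `x` to `y`. -/
noncomputable def queryIndicator (F : Type*) [Field F] {V : Type*} [AddCommGroup V] [Module F V]
    {W : Type*} [AddCommGroup W] [Module F W] (x : V) (y : W) : (V →ₗ[F] W) → ℂ :=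
  fun L => if L x = y then 1 else 0

/-- The span of the query indicators. Its `t`-th power contains everything that depends on the
unknown map through `t` queries. -/
def querySpan (F V W : Type*) [Field F] [AddCommGroup V] [Module F V] [AddCommGroup W]
    [Module F W] : Submodule ℂ ((V →ₗ[F] W) → ℂ) :=
  Submodule.span ℂ (Set.range fun p : V × W => queryIndicator F p.1 p.2)

/-- The sum of `f (h ∘ L ∘ g)` over all automorphisms `g` of the source and `h` of the target. -/
def automorphismSum [Fintype (V ≃ₗ[F] V)] [Fintype (W ≃ₗ[F] W)] (f : (V →ₗ[F] W) → ℂ) :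
    (V →ₗ[F] W) → ℂ :=
  fun L => ∑ g : V ≃ₗ[F] V, ∑ h : W ≃ₗ[F] W, f (h.toLinearMap ∘ₗ L ∘ₗ g.toLinearMap)

open Classical in
theorem sum_linearEquiv_comp [Fintype (V ≃ₗ[F] V)] [Finite T] [Finite V] [Fintype (T →ₗ[F] V)]
    (φ : (T →ₗ[F] V) → ℂ) (X : T →ₗ[F] V) :
    ∑ g : V ≃ₗ[F] V, φ (g.toLinearMap ∘ₗ X) =
      Nat.card {g : V ≃ₗ[F] V // g.toLinearMap ∘ₗ X = X} *
        ∑ Z : T →ₗ[F] V, if ker Z = ker X then φ Z else 0 := by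
  rw [← Finset.sum_fiberwise_of_maps_to (t := Finset.univ) (g := fun g : V ≃ₗ[F] V =>
    g.toLinearMap ∘ₗ X) (fun _ _ => Finset.mem_univ _), Finset.mul_sum]
  refine Finset.sum_congr rfl fun Z _ => ?_
  have h := natCard_linearEquiv_comp_eq' X Z
  rw [Nat.card_eq_fintype_card, Fintype.card_subtype] at h
  rw [Finset.sum_congr rfl (g := fun _ => φ Z)
    (fun g hg => by rw [(Finset.mem_filter.1 hg).2]), Finset.sum_const, h]
  split_ifs <;> simp

open Polynomial in
open Classical in
-- Summing over `h` relaxes `L ∘ Z = Y` to equality of kernels, and summing over `g` lets `Z` run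
-- over all maps with the kernel of `X`. What remains is the count of `Z` with two prescribed
-- kernels.
theorem exists_polynomial_automorphismSum_comp [Finite F] [Finite T] [Finite V] [Finite W]
    [Fintype (V ≃ₗ[F] V)] [Fintype (W ≃ₗ[F] W)] (X : T →ₗ[F] V) (Y : T →ₗ[F] W) :
    ∃ P : ℂ[X], P.natDegree ≤ finrank F T ∧ ∀ L : V →ₗ[F] W,
      automorphismSum (fun L => if L ∘ₗ X = Y then 1 else 0) L =
        P.eval (Nat.card (ker L) : ℂ) := by
  have := Fintype.ofFinite (T →ₗ[F] V)
  obtain ⟨P, hP, h⟩ := exists_polynomial_natCard_ker_eq (V := V) (W := W) (ker X, ker Y)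
  set cX := Nat.card {g : V ≃ₗ[F] V // g.toLinearMap ∘ₗ X = X}
  set cY := Nat.card {g : W ≃ₗ[F] W // g.toLinearMap ∘ₗ Y = Y} with hcY
  refine ⟨C ((cX : ℂ) * cY) * P, (natDegree_C_mul_le _ _).trans hP, fun L => ?_⟩
  have h1 : ∀ Z : T →ₗ[F] V, (∑ k : W ≃ₗ[F] W, if k.toLinearMap ∘ₗ L ∘ₗ Z = Y then (1 : ℂ) else 0)
      = if ker (L ∘ₗ Z) = ker Y then (cY : ℂ) else 0 := by
    intro Z
    have h2 := natCard_linearEquiv_comp_eq (L ∘ₗ Z) Y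
    rw [Nat.card_eq_fintype_card, Fintype.card_subtype] at h2
    rw [Finset.sum_boole, h2]
    split_ifs <;> simp [hcY]
  have h3 : automorphismSum (fun L => if L ∘ₗ X = Y then 1 else 0) L =
      ∑ g : V ≃ₗ[F] V, if ker (L ∘ₗ (g.toLinearMap ∘ₗ X)) = ker Y then (cY : ℂ) else 0 :=
    Finset.sum_congr rfl fun g _ => h1 (g.toLinearMap ∘ₗ X)
  have hL := h L
  rw [Nat.card_eq_fintype_card, Fintype.card_subtype] at hL
  rw [h3, sum_linearEquiv_comp (fun Z => if ker (L ∘ₗ Z) = ker Y then (cY : ℂ) else 0), eval_mul,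
    eval_C, ← hL, mul_assoc]
  congr 1
  rw [mul_comm, ← nsmul_eq_mul, ← Finset.sum_const, Finset.sum_filter]
  refine Finset.sum_congr rfl fun Z _ => ?_
  rw [← ite_and]
  simp only [Prod.mk.injEq]

open Polynomial in
/-- The automorphism sum of a function of `t` queries is a polynomial of degree at most `t` in the
cardinality of the kernel. -/
theorem exists_polynomial_automorphismSum [Finite F] [Finite V] [Finite W]
    [Fintype (V ≃ₗ[F] V)] [Fintype (W ≃ₗ[F] W)] {t : ℕ} {f : (V →ₗ[F] W) → ℂ}
    (hf : f ∈ querySpan F V W ^ t) :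
    ∃ P : ℂ[X], P.natDegree ≤ t ∧ ∀ L : V →ₗ[F] W,
      automorphismSum f L = P.eval (Nat.card (ker L) : ℂ) := by
  rw [querySpan, Submodule.span_pow] at hf
  induction hf using Submodule.span_induction with
  | mem f hf =>
    classical
    obtain ⟨u, hu, rfl⟩ := Set.mem_pow_iff_prod.1 hf
    choose p hp using hu
    -- The `t` conditions `L xᵢ = yᵢ` are one equation `L ∘ X = Y` of maps out of `F ^ t`; the `xᵢ`
    -- may be dependent or repeated.
    obtain ⟨P, hP, h⟩ := exists_polynomial_automorphismSum_comp
      (Fintype.linearCombination F fun i => (p i).1) (Fintype.linearCombination F fun i => (p i).2)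
    rw [finrank_fin_fun] at hP
    refine ⟨P, hP, fun L => ?_⟩
    rw [← h L]
    congr 1
    funext M
    have : M ∘ₗ (Fintype.linearCombination F fun i => (p i).1) =
        (Fintype.linearCombination F fun i => (p i).2) ↔ ∀ i, M (p i).1 = (p i).2 := by
      constructor
      · intro h i
        simpa using LinearMap.congr_fun h (Pi.single i 1)
      · intro h
        ext i
        simp [h]
    simp only [this, Finset.prod_apply, ← hp, queryIndicator, Finset.prod_ite_zero,
      Finset.mem_univ, true_imp_iff, Finset.prod_const_one]
  | zero => exact ⟨0, by simp, fun L => by simp [automorphismSum]⟩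
  | add f g _ _ hf hg =>
    obtain ⟨P, hP, h⟩ := hf
    obtain ⟨Q, hQ, h'⟩ := hg
    exact ⟨P + Q, natDegree_add_le_of_degree_le hP hQ, fun L => by
      rw [eval_add, ← h, ← h']
      simp [automorphismSum, Finset.sum_add_distrib]⟩
  | smul a f _ hf =>
    obtain ⟨P, hP, h⟩ := hf
    exact ⟨C a * P, (natDegree_C_mul_le _ _).trans hP, fun L => by
      rw [eval_mul, eval_C, ← h]
      simp [automorphismSum, Finset.mul_sum]⟩

theorem star_mem_querySpan_pow {t : ℕ} {f : (V →ₗ[F] W) → ℂ} (hf : f ∈ querySpan F V W ^ t) :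
    star f ∈ querySpan F V W ^ t := by
  rw [querySpan, Submodule.span_pow] at hf ⊢
  induction hf using Submodule.span_induction with
  | mem f hf =>
    refine Submodule.subset_span ?_
    have : star f = f := by
      obtain ⟨u, hu, rfl⟩ := Set.mem_pow_iff_prod.1 hf
      rw [star_prod]
      refine Finset.prod_congr rfl fun i _ => ?_
      obtain ⟨p, hp⟩ := hu i
      rw [← hp]
      funext L
      simp only [Pi.star_apply, queryIndicator]
      split_ifs <;> simp
    rwa [this]
  | zero => simp
  | add f g _ _ hf hg => rw [star_add]; exact add_mem hf hg
  | smul a f _ hf => rw [star_smul]; exact Submodule.smul_mem _ _ hf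

end Averaging

/-! ## Polynomials bounded on a geometric progression -/

section Interpolation

open Polynomial

/-- A polynomial of degree at most `d` that is bounded by `B` at `1, q, …, q ^ d` has coefficients
whose absolute values sum to at most `13 ^ d * B`. -/
theorem sum_norm_coeff_le_of_geometric {q : ℝ} (hq : 2 ≤ q) (d : ℕ) (P : ℂ[X]) (B : ℝ)
    (hP : P.natDegree ≤ d) (hB : ∀ i ≤ d, ‖P.eval ((q : ℂ) ^ i)‖ ≤ B) :
    ∑ j ∈ Finset.range (d + 1), ‖P.coeff j‖ ≤ 13 ^ d * B := by
  induction d generalizing P B with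
  | zero =>
    have h := hB 0 le_rfl
    rw [eq_C_of_natDegree_le_zero hP] at h ⊢
    simpa using h
  | succ d ih =>
    have hq0 : (0 : ℝ) ≤ q := by linarith
    have hB0 : 0 ≤ B := (norm_nonneg _).trans (hB 0 (Nat.zero_le _))
    have hqd : 2 ≤ q ^ (d + 1) := by
      have := pow_le_pow_right₀ (by linarith : (1 : ℝ) ≤ q) (Nat.le_add_left 1 d)
      linarith [pow_one q]
    -- `Q` loses the coefficient of degree `d + 1`, while each lower one is multiplied by at least
    -- `q ^ (d + 1) / 2`.
    set Q : ℂ[X] := C ((q : ℂ) ^ (d + 1)) * P - P.comp (C (q : ℂ) * X) with hQ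
    have hcoeff : ∀ j, Q.coeff j = ((q : ℂ) ^ (d + 1) - (q : ℂ) ^ j) * P.coeff j := by
      intro j
      rw [hQ, coeff_sub, coeff_C_mul, comp_C_mul_X_coeff]
      ring
    have hdeg : Q.natDegree ≤ d := by
      rw [natDegree_le_iff_coeff_eq_zero]
      intro j hj
      rw [hcoeff]
      rcases (Nat.succ_le_of_lt hj).eq_or_lt with rfl | h
      · simp
      · rw [coeff_eq_zero_of_natDegree_lt (hP.trans_lt h), mul_zero]
    have hbound : ∀ i ≤ d, ‖Q.eval ((q : ℂ) ^ i)‖ ≤ (q ^ (d + 1) + 1) * B := by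
      intro i hi
      have h1 := hB i (by omega)
      have h2 := hB (i + 1) (by omega)
      have : Q.eval ((q : ℂ) ^ i) =
          (q : ℂ) ^ (d + 1) * P.eval ((q : ℂ) ^ i) - P.eval ((q : ℂ) ^ (i + 1)) := by
        simp [hQ, pow_succ']
      rw [this]
      refine (norm_sub_le _ _).trans ?_
      rw [norm_mul, norm_pow, Complex.norm_real, Real.norm_of_nonneg hq0, add_mul, one_mul]
      gcongr
    have hQsum := ih Q _ hdeg hbound
    have hlow : q ^ (d + 1) / 2 * ∑ j ∈ Finset.range (d + 1), ‖P.coeff j‖ ≤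
        ∑ j ∈ Finset.range (d + 1), ‖Q.coeff j‖ := by
      rw [Finset.mul_sum]
      refine Finset.sum_le_sum fun j hj => ?_
      rw [hcoeff, norm_mul]
      gcongr
      have h1 : q ^ j ≤ q ^ d := pow_le_pow_right₀ (by linarith)
        (Nat.lt_succ_iff.1 (Finset.mem_range.1 hj))
      have h2 : q ^ d * 2 ≤ q ^ (d + 1) := by
        rw [pow_succ]; gcongr
      have h3 : ((q : ℂ) ^ (d + 1) - (q : ℂ) ^ j) = ((q ^ (d + 1) - q ^ j : ℝ) : ℂ) := by
        push_cast; rfl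
      rw [h3, Complex.norm_real]
      refine le_trans ?_ (le_abs_self _)
      linarith
    -- The `3` bounds `2 * (q ^ (d + 1) + 1) / q ^ (d + 1)`. The top coefficient, recovered from
    -- `P.eval 1`, then costs at most `B` plus this sum again.
    have hsum : ∑ j ∈ Finset.range (d + 1), ‖P.coeff j‖ ≤ 3 * (13 ^ d * B) := by
      have hpos : 0 ≤ 13 ^ d * B := by positivity
      by_contra! hlt
      have h1 : q ^ (d + 1) / 2 * (3 * (13 ^ d * B)) <
          q ^ (d + 1) / 2 * ∑ j ∈ Finset.range (d + 1), ‖P.coeff j‖ := by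
        gcongr
      nlinarith [mul_le_mul_of_nonneg_right hqd hpos]
    have htop : ‖P.coeff (d + 1)‖ ≤ B + ∑ j ∈ Finset.range (d + 1), ‖P.coeff j‖ := by
      have h1 := hB 0 (Nat.zero_le _)
      have h2 : P.coeff (d + 1) = P.eval 1 - ∑ j ∈ Finset.range (d + 1), P.coeff j := by
        rw [eval_eq_sum_range' (Nat.lt_succ_of_le hP), Finset.sum_range_succ]
        simp
      rw [h2]
      rw [pow_zero] at h1
      refine (norm_sub_le _ _).trans (add_le_add h1 (norm_sum_le _ _))
    have h13 : B ≤ 13 ^ d * B := le_mul_of_one_le_left hB0 (one_le_pow₀ (by norm_num))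
    rw [Finset.sum_range_succ, pow_succ]
    linarith

/-- A polynomial of degree at most `d` that is bounded by `1` at `1, q, …, q ^ d` varies little
near `0`. -/
theorem norm_eval_sub_eval_le_of_geometric {q : ℝ} (hq : 2 ≤ q) {d : ℕ} {P : ℂ[X]}
    (hP : P.natDegree ≤ d) (hB : ∀ i ≤ d, ‖P.eval ((q : ℂ) ^ i)‖ ≤ 1) {x y : ℂ} {δ : ℝ}
    (hδ : δ ≤ 1) (hx : ‖x‖ ≤ δ) (hy : ‖y‖ ≤ δ) :
    ‖P.eval x - P.eval y‖ ≤ 2 * 13 ^ d * δ := by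
  have hδ0 : 0 ≤ δ := (norm_nonneg _).trans hx
  have h := sum_norm_coeff_le_of_geometric hq d P 1 hP hB
  rw [eval_eq_sum_range' (Nat.lt_succ_of_le hP), eval_eq_sum_range' (Nat.lt_succ_of_le hP),
    ← Finset.sum_sub_distrib]
  calc _ ≤ ∑ j ∈ Finset.range (d + 1), ‖P.coeff j‖ * (2 * δ) := by
        refine norm_sum_le_of_le _ fun j _ => ?_
        rw [← mul_sub, norm_mul]
        gcongr
        rcases j.eq_zero_or_pos with rfl | hj
        · simpa using hδ0
        · have aux : ∀ z : ℂ, ‖z‖ ≤ δ → ‖z ^ j‖ ≤ δ := fun z hz => by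
            rw [norm_pow]
            exact (pow_le_of_le_one (norm_nonneg _) (hz.trans hδ) hj.ne').trans hz
          linarith [norm_sub_le (x ^ j) (y ^ j), aux x hx, aux y hy]
    _ = (∑ j ∈ Finset.range (d + 1), ‖P.coeff j‖) * (2 * δ) := by rw [Finset.sum_mul]
    _ ≤ 13 ^ d * 1 * (2 * δ) := by gcongr
    _ = _ := by ring

end Interpolation

/-! ## Acceptance probabilities as functions of the queried matrix -/

namespace MatVec.QueryAlgorithm

variable {F : Type*} [Field F] [Fintype F] [DecidableEq F] {m n : ℕ}

/-- Gates take fixed linear combinations of amplitudes; an oracle call multiplies by indicators,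
through a sum over the previous contents `y` of the answer register. -/
theorem state_mem_querySpan_pow (A : QueryAlgorithm F m n) (k : ℕ) (b : Label F m n A.workDim) :
    (fun L : (Fin n → F) →ₗ[F] (Fin m → F) => A.state (LinearMap.toMatrix' L) k b) ∈
      querySpan F (Fin n → F) (Fin m → F) ^ k := by
  induction k generalizing b with
  | zero =>
    rw [pow_zero, Submodule.mem_one]
    exact ⟨A.state 0 0 b, rfl⟩
  | succ k ih =>
    have hstep : ∀ c : Label F m n A.workDim, (fun L : (Fin n → F) →ₗ[F] (Fin m → F) =>
        oracle (LinearMap.toMatrix' L) (A.state (LinearMap.toMatrix' L) k) c) ∈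
        querySpan F (Fin n → F) (Fin m → F) ^ (k + 1) := by
      intro c
      have : (fun L : (Fin n → F) →ₗ[F] (Fin m → F) =>
          oracle (LinearMap.toMatrix' L) (A.state (LinearMap.toMatrix' L) k) c) =
          ∑ y : Fin m → F, (fun L => A.state (LinearMap.toMatrix' L) k (c.1, y, c.2.2)) *
            queryIndicator F c.1 (c.2.1 - y) := by
        funext L
        rw [Finset.sum_apply, Finset.sum_eq_single (c.2.1 - L c.1)]
        · simp [queryIndicator, oracle, LinearMap.toMatrix'_mulVec]
        · intro y _ hy
          have : L c.1 ≠ c.2.1 - y := fun h => hy (by rw [h]; abel)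
          simp [queryIndicator, this]
        · simp
      rw [this, pow_succ]
      exact Submodule.sum_mem _ fun y _ => Submodule.mul_mem_mul (ih _)
        (Submodule.subset_span ⟨(c.1, c.2.1 - y), rfl⟩)
    have : (fun L : (Fin n → F) →ₗ[F] (Fin m → F) =>
        A.state (LinearMap.toMatrix' L) (k + 1) b) =
        ∑ c, (A.gate (k + 1)).1 b c • fun L : (Fin n → F) →ₗ[F] (Fin m → F) =>
          oracle (LinearMap.toMatrix' L) (A.state (LinearMap.toMatrix' L) k) c := by
      funext L
      simp [state, Matrix.mulVec, dotProduct]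
    rw [this]
    exact Submodule.sum_mem _ fun c _ => Submodule.smul_mem _ _ (hstep c)

/-- A probability is a sum of amplitudes times their conjugates, which doubles the degree. -/
theorem acceptProb_mem_querySpan_pow (A : QueryAlgorithm F m n) :
    (fun L : (Fin n → F) →ₗ[F] (Fin m → F) => (A.acceptProb (LinearMap.toMatrix' L) : ℂ)) ∈
      querySpan F (Fin n → F) (Fin m → F) ^ (2 * A.queries) := by
  have : (fun L : (Fin n → F) →ₗ[F] (Fin m → F) => (A.acceptProb (LinearMap.toMatrix' L) : ℂ)) =
      ∑ b ∈ A.accept, (fun L => A.state (LinearMap.toMatrix' L) A.queries b) *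
        star (fun L => A.state (LinearMap.toMatrix' L) A.queries b) := by
    funext L
    simp only [acceptProb, Finset.sum_apply, Pi.mul_apply, Pi.star_apply]
    push_cast
    exact Finset.sum_congr rfl fun b _ => (Complex.mul_conj' _).symm
  rw [this, two_mul, pow_add]
  exact Submodule.sum_mem _ fun b _ => Submodule.mul_mem_mul (A.state_mem_querySpan_pow _ b)
    (star_mem_querySpan_pow (A.state_mem_querySpan_pow _ b))

theorem acceptProb_nonneg (A : QueryAlgorithm F m n) (M : Matrix (Fin m) (Fin n) F) :
    0 ≤ A.acceptProb M :=
  Finset.sum_nonneg fun _ _ => sq_nonneg _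

end MatVec.QueryAlgorithm

namespace MatVec.QueryAlgorithm

open Polynomial LinearMap Module

variable {F : Type*} [Field F] [Fintype F] [DecidableEq F] {m n : ℕ}

theorem exists_linearMap_finrank_range_eq {F : Type*} [Field F] {m n r : ℕ} (hn : r ≤ n) (hm : r ≤ m) :
    ∃ L : (Fin n → F) →ₗ[F] (Fin m → F), finrank F (range L) = r := by
  obtain ⟨ι, hι⟩ := (finrank_le_iff_exists_linearMap (R := F) (M := Fin r → F)
    (M' := Fin m → F)).1 (by simpa using hm)
  refine ⟨ι ∘ₗ funLeft F F (Fin.castLE hn), ?_⟩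
  rw [range_comp, range_eq_top.2 (funLeft_surjective_of_injective F F _
    (Fin.castLE_injective hn)), Submodule.map_top, finrank_range_of_inj hι, finrank_fin_fun]

/-- The acceptance probability averaged over all matrices of a given rank is a polynomial of degree
at most twice the number of queries in the cardinality of the kernel. -/
theorem exists_polynomial_of_testsRank (hmn : n ≤ m) (A : QueryAlgorithm F m n) {ε : ℝ}
    (hA : A.TestsRank ε) :
    ∃ P : ℂ[X], P.natDegree ≤ 2 * A.queries ∧
      (∃ v : ℝ, 1 - ε ≤ v ∧ P.eval 1 = (v : ℂ)) ∧
      ∀ j ≤ n, n ≤ 2 * j → ∃ v : ℝ, 0 ≤ v ∧ v ≤ ε ∧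
        P.eval (((Fintype.card F : ℝ) : ℂ) ^ j) = (v : ℂ) := by
  classical
  have := Fintype.ofFinite ((Fin n → F) ≃ₗ[F] (Fin n → F))
  have := Fintype.ofFinite ((Fin m → F) ≃ₗ[F] (Fin m → F))
  obtain ⟨P, hdeg, hP⟩ := exists_polynomial_automorphismSum A.acceptProb_mem_querySpan_pow
  set G := ((Fin n → F) ≃ₗ[F] (Fin n → F)) × ((Fin m → F) ≃ₗ[F] (Fin m → F))
  have hN : (0 : ℝ) < Fintype.card G := by exact_mod_cast Fintype.card_pos
  let act : G → ((Fin n → F) →ₗ[F] (Fin m → F)) → Matrix (Fin m) (Fin n) F := fun p L =>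
    toMatrix' (p.2.toLinearMap ∘ₗ L ∘ₗ p.1.toLinearMap)
  have hact : ∀ p L, (act p L).rank = finrank F (range L) := by
    intro p L
    rw [Matrix.rank, ← Matrix.toLin'_apply', Matrix.toLin'_toMatrix', range_comp,
      LinearEquiv.finrank_map_eq, range_comp, LinearEquiv.range, Submodule.map_top]
  let v : ((Fin n → F) →ₗ[F] (Fin m → F)) → ℝ := fun L =>
    (∑ p : G, A.acceptProb (act p L)) / Fintype.card G
  have hv : ∀ L, (C ((Fintype.card G : ℂ)⁻¹) * P).eval (Nat.card (ker L) : ℂ) = (v L : ℂ) := by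
    intro L
    rw [eval_mul, eval_C, ← hP, automorphismSum, ← Fintype.sum_prod_type', mul_comm,
      ← div_eq_mul_inv]
    push_cast [v, act]
    rfl
  have hker : ∀ j ≤ n, ∃ L : (Fin n → F) →ₗ[F] (Fin m → F), finrank F (range L) = n - j ∧
      (Nat.card (ker L) : ℂ) = ((Fintype.card F : ℝ) : ℂ) ^ j := by
    intro j hj
    obtain ⟨L, hL⟩ := exists_linearMap_finrank_range_eq (F := F) (r := n - j) (n := n) (m := m)
      (by omega) (by omega)
    have h := finrank_range_add_finrank_ker L
    rw [finrank_fin_fun, hL] at h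
    have h' : finrank F (ker L) = j := by omega
    refine ⟨L, hL, ?_⟩
    rw [natCard_eq_pow_finrank (K := F), h', Nat.card_eq_fintype_card]
    push_cast
    rfl
  refine ⟨C ((Fintype.card G : ℂ)⁻¹) * P, (natDegree_C_mul_le _ _).trans hdeg, ?_, ?_⟩
  · obtain ⟨L, hL, hc⟩ := hker 0 (Nat.zero_le _)
    rw [pow_zero] at hc
    refine ⟨v L, ?_, by rw [← hv, hc]⟩
    rw [le_div_iff₀ hN, mul_comm, ← nsmul_eq_mul]
    exact Finset.card_nsmul_le_sum _ _ _ fun p _ => hA.1 _ (by rw [hact, hL, Nat.sub_zero])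
  · intro j hj hnj
    obtain ⟨L, hL, hc⟩ := hker j hj
    refine ⟨v L, div_nonneg (Finset.sum_nonneg fun p _ => A.acceptProb_nonneg _) hN.le, ?_,
      by rw [← hv, hc]⟩
    rw [div_le_iff₀ hN, mul_comm, ← nsmul_eq_mul]
    refine Finset.sum_le_card_nsmul _ _ _ fun p _ => hA.2 _ ?_
    rw [hact, hL, le_div_iff₀ two_pos]
    exact_mod_cast (by omega : (n - j) * 2 ≤ n)

end MatVec.QueryAlgorithm

open Polynomial in
/-- A polynomial that is small at the larger half of `1, q, …, q ^ n` and large at `1` has degree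
linear in `n`. -/
theorem le_natDegree_of_geometric_gap {q ε : ℝ} (hq : 2 ≤ q) (hε1 : ε ≤ 1) {l n d : ℕ}
    (hl : (1 / 2 : ℝ) ^ l < 1 - 2 * ε) {P : ℂ[X]} (hP : P.natDegree ≤ d) {v : ℝ}
    (hv : 1 - ε ≤ v) (h1 : P.eval 1 = (v : ℂ))
    (h : ∀ j ≤ n, n ≤ 2 * j → ∃ v : ℝ, 0 ≤ v ∧ v ≤ ε ∧ P.eval ((q : ℂ) ^ j) = (v : ℂ)) :
    n ≤ 10 * d + 2 * l + 3 := by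
  by_contra! hn
  have hq0 : (q : ℂ) ≠ 0 := by
    have : q ≠ 0 := by linarith
    exact_mod_cast this
  -- The nodes `q ^ s, …, q ^ n` all lie in the rejecting range; `j = ⌈n / 2⌉` is the smallest
  -- rejecting exponent. In the rescaled variable, `1` and `q ^ j` become `q⁻¹ ^ s` and `q⁻¹ ^ (s -
  -- j)`.
  set s := n - d with hs
  set j := (n + 1) / 2 with hj
  set R : ℂ[X] := P.comp (C ((q : ℂ) ^ s) * X) with hR
  have hReval : ∀ z, R.eval z = P.eval ((q : ℂ) ^ s * z) := fun z => by simp [hR]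
  have hRdeg : R.natDegree ≤ d := by
    rw [hR, natDegree_comp]
    rwa [natDegree_C_mul_X _ (pow_ne_zero s hq0), mul_one]
  have hRB : ∀ i ≤ d, ‖R.eval ((q : ℂ) ^ i)‖ ≤ 1 := by
    intro i hi
    obtain ⟨w, hw0, hw1, hw⟩ := h (s + i) (by omega) (by omega)
    rw [hReval, ← pow_add, hw, Complex.norm_real, Real.norm_of_nonneg hw0]
    exact hw1.trans hε1
  obtain ⟨w, hw0, hw1, hw⟩ := h j (by omega) (by omega)
  have hqinv : q⁻¹ ≤ 1 / 2 := by
    rw [one_div]; exact inv_anti₀ two_pos hq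
  have hqinv0 : 0 ≤ q⁻¹ := inv_nonneg.2 (by linarith)
  have hpow : ∀ e ≥ s - j, ‖((q : ℂ)⁻¹) ^ e‖ ≤ (1 / 2 : ℝ) ^ (s - j) := by
    intro e he
    rw [norm_pow, norm_inv, Complex.norm_real, Real.norm_of_nonneg (by linarith)]
    exact (pow_le_pow_left₀ hqinv0 hqinv e).trans
      (pow_le_pow_of_le_one (by norm_num) (by norm_num) he)
  have hmul : ∀ e ≤ s, (q : ℂ) ^ s * ((q : ℂ)⁻¹) ^ e = (q : ℂ) ^ (s - e) := by
    intro e he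
    rw [pow_sub₀ _ hq0 he, inv_pow]
  have key := norm_eval_sub_eval_le_of_geometric hq hRdeg hRB
    (pow_le_one₀ (n := s - j) (by norm_num) (by norm_num)) (hpow s (Nat.sub_le _ _))
    (hpow (s - j) le_rfl)
  rw [hReval, hReval, hmul s le_rfl, hmul _ (Nat.sub_le _ _), Nat.sub_self, pow_zero, h1,
    Nat.sub_sub_self (by omega), hw, ← Complex.ofReal_sub, Complex.norm_real] at key
  have hgap : 1 - 2 * ε ≤ 2 * 13 ^ d * (1 / 2) ^ (s - j) := by
    refine le_trans ?_ key
    refine le_trans ?_ (le_abs_self _)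
    linarith
  -- The `4 * d` absorbs `13 ^ d ≤ 2 ^ (4 * d)`, the `1` absorbs the factor `2`, and `l` beats the
  -- gap.
  have hsj : s - j = (l + 4 * d + 1) + (s - j - (l + 4 * d + 1)) := by omega
  have hsmall : 2 * 13 ^ d * (1 / 2 : ℝ) ^ (s - j) ≤ (1 / 2) ^ l := by
    have h13 : (13 : ℝ) ^ d ≤ 16 ^ d := pow_le_pow_left₀ (by norm_num) (by norm_num) _
    calc 2 * 13 ^ d * (1 / 2 : ℝ) ^ (s - j) ≤ 2 * 16 ^ d * (1 / 2 : ℝ) ^ (l + 4 * d + 1) := by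
          gcongr ?_ * ?_
          · gcongr
          · exact pow_le_pow_of_le_one (by norm_num) (by norm_num) (by omega)
      _ = (16 * (1 / 2) ^ 4) ^ d * (1 / 2) ^ l := by
          rw [mul_pow, pow_add, pow_add, pow_mul]; ring
      _ = (1 / 2) ^ l := by norm_num
  linarith

theorem mainTheorem6 (ε : ℝ) (hε0 : 0 ≤ ε) (hε : ε < 1 / 2) :
    ∃ c : ℝ, 0 < c ∧
      ∀ (F : Type*) [Field F] [Fintype F] [DecidableEq F] (m n : ℕ), n ≤ m →
        ∀ A : MatVec.QueryAlgorithm F m n, A.TestsRank ε → c * (n : ℝ) ≤ (A.queries : ℝ) := by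
  obtain ⟨l, hl⟩ := exists_pow_lt_of_lt_one (by linarith : 0 < 1 - 2 * ε)
    (by norm_num : (1 / 2 : ℝ) < 1)
  -- With `d = 2 * A.queries`, the bound `10 * d + 2 * l + 3` is at most `(2 * l + 23) * A.queries`
  -- once there is a query. With none, `P` is constant, which contradicts the gap when `n > 0`.
  refine ⟨1 / (2 * l + 23), by positivity, fun F _ _ _ m n hmn A hA => ?_⟩
  obtain ⟨P, hP, ⟨v, hv, h1⟩, h⟩ := A.exists_polynomial_of_testsRank hmn hA
  have hq : (2 : ℝ) ≤ Fintype.card F := by exact_mod_cast Fintype.one_lt_card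
  have hn := le_natDegree_of_geometric_gap hq (by linarith) hl hP hv h1 h
  have hbound : n ≤ (2 * l + 23) * A.queries := by
    rcases A.queries.eq_zero_or_pos with hk | hk
    · rcases n.eq_zero_or_pos with rfl | hn0
      · exact Nat.zero_le _
      · exfalso
        rw [hk, Nat.mul_zero, Nat.le_zero] at hP
        obtain ⟨w, -, hw1, hw⟩ := h n le_rfl (by omega)
        rw [Polynomial.eq_C_of_natDegree_eq_zero hP, Polynomial.eval_C] at h1 hw
        have : v = w := by exact_mod_cast h1.symm.trans hw
        linarith
    · nlinarith
  rw [one_div, inv_mul_le_iff₀ (by positivity)]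
  exact_mod_cast hbound
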